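/- Let $\mathcal A$ and $\mathcal B$ be von Neumann algebras acting on complex Hilbert spaces $K$ and $H$ respectively, and suppose that there is a $*$-isomorphism $\pi:\mathcal A'\to\mathcal B'$ between their commutants. For a linear space $\mathcal U\subset B(H_1,H_2)$ of bounded operators between Hilbert spaces and $T\in B(H_1,H_2)$ put $d(T,\mathcal U)=\inf_{X\in\mathcal U}\|T-X\|$ and $$r_{\mathcal U}(T)=\sup\{|\langle T\xi,\eta\rangle| : \|\xi\|=\|\eta\|=1,\ \langle X\xi,\eta\rangle=0\ \text{for all } X\in\mathcal U\},$$ and let $k(\mathcal U)=\sup_{T\notin\mathcal U} d(T,\mathcal U)/r_{\mathcal U}(T)\in[0,\infty]$ be the hyperreflexivity constant of $\mathcal U$ (here $\sup\emptyset=0$, and $c/0=\infty$ for $c>0$). For a cardinal $I$ let $M_I^w(\mathcal U)$ be the space of $I\times I$ matrices with entries in $\mathcal U$ whose finite submatrices have uniformly bounded norm, regarded as a space of bounded operators from the Hilbert direct sum $H_1^I$ to $H_2^I$. If $I$ is an infinite cardinal greater than or equal to the cardinality of an orthonormal basis of $H$, then $$k(M_I^w(\mathcal B))\le k(M_I^w(\mathcal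 A)).$$ If, moreover, $H$ and $K$ are both separable, then $k(M_{\aleph_0}^w(\mathcal B))=k(M_{\aleph_0}^w(\mathcal A))$, that is, $\mathcal A$ and $\mathcal B$ have the same complete hyperreflexivity constant. -/

import Mathlib

open scoped ENNReal

universe u v w x

noncomputable section

namespace Hyperreflexivity

/-- The Hilbert space `H^I`, the Hilbert direct sum of `I` copies of `H`. -/
abbrev Ampl (I : Type*) (H : Type*) [NormedAddCommGroup H] : Type _ :=
  lp (fun _ : I => H) 2

section Constant

variable {H K : Type*} [NormedAddCommGroup H] [InnerProductSpace ℂ H]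
  [NormedAddCommGroup K] [InnerProductSpace ℂ K]

/-- The operator-norm distance `d(T, U) = inf {‖T - X‖ : X ∈ U}`. It is always finite, as `0 ∈ U`. -/
def dist (U : Submodule ℂ (H →L[ℂ] K)) (T : H →L[ℂ] K) : ℝ≥0∞ :=
  ⨅ X ∈ U, ‖T - X‖ₑ

/-- `r_U(T)`, the supremum of `|⟨T ξ, η⟩|` over all unit vectors `ξ ∈ H`, `η ∈ K` with
`⟨X ξ, η⟩ = 0` for every `X ∈ U` (the supremum is `0` if there are no such pairs). -/
def rad (U : Submodule ℂ (H →L[ℂ] K)) (T : H →L[ℂ] K) : ℝ≥0∞ :=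
  ⨆ (ξ : H) (η : K) (_ : ‖ξ‖ = 1) (_ : ‖η‖ = 1) (_ : ∀ X ∈ U, inner ℂ (X ξ) η = 0),
    ‖inner ℂ (T ξ) η‖ₑ

/-- The hyperreflexivity constant `k(U) = sup {d(T, U) / r_U(T) : T ∉ U}` in `[0, ∞]`.
For `U` norm closed and `T ∉ U` the numerator is nonzero and finite, so a vanishing `r_U(T)`
gives the quotient `∞`. The supremum over the empty set (`U` all of `B(H, K)`) is `0`. -/
def hyperConst (U : Submodule ℂ (H →L[ℂ] K)) : ℝ≥0∞ :=
  ⨆ (T : H →L[ℂ] K) (_ : T ∉ U), dist U T / rad U T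

open scoped Classical in
/-- The `(i, j)` entry of an operator `H^I → K^I`, regarded as an `I × I` operator matrix:
embed `H` as the `j`-th summand, apply the operator, take the `i`-th coordinate. -/
def entry {I : Type*} (T : Ampl I H →L[ℂ] Ampl I K) (i j : I) : H →L[ℂ] K :=
  (lp.evalCLM ℂ (fun _ : I => K) 2 i) ∘L T ∘L
    (lp.singleContinuousLinearMap ℂ (fun _ : I => H) 2 j)

/-- `M_I^w(U)`: the `I × I` matrices with entries in `U` whose finite submatrices are uniformly
bounded in norm, i.e. the matrices with entries in `U` of bounded operators `H^I → K^I`,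
as a space of operators `H^I → K^I`. -/
def matrixSpace (I : Type*) (U : Submodule ℂ (H →L[ℂ] K)) :
    Submodule ℂ (Ampl I H →L[ℂ] Ampl I K) where
  carrier := {T | ∀ i j, entry T i j ∈ U}
  add_mem' {S T} hS hT i j := by
    have h : entry (S + T) i j = entry S i j + entry T i j := by
      ext x; simp [entry]
    rw [h]; exact U.add_mem (hS i j) (hT i j)
  zero_mem' i j := by
    have h : entry (0 : Ampl I H →L[ℂ] Ampl I K) i j = 0 := by
      ext x; simp [entry]
    rw [h]; exact U.zero_mem
  smul_mem' c T hT i j := by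
    have h : entry (c • T) i j = c • entry T i j := by
      ext x; simp [entry]
    rw [h]; exact U.smul_mem c (hT i j)

end Constant

/-- The underlying linear space of operators of a von Neumann algebra. -/
def opSpace {H : Type*} [NormedAddCommGroup H] [InnerProductSpace ℂ H] [CompleteSpace H]
    (A : VonNeumannAlgebra H) : Submodule ℂ (H →L[ℂ] H) :=
  Subalgebra.toSubmodule A.toStarSubalgebra.toSubalgebra

end Hyperreflexivity

end

/-!
The operators in `M_I^w(B)` are those commuting with the diagonal action of `B'` on `H^I`; through
`π` both `M_I^w(A)` and `M_I^w(B)` are commutants of amplified representations of one von Neumann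
algebra `M = A'`, which acts on `K` identically and on `H` by `π`. If an isometry `W : H^I → K^I`
intertwines the two actions, then `T ↦ W T W*` embeds `M_I^w(B)` as a corner of `M_I^w(A)`; it
does not decrease distances and does not increase `r`, so `k(M_I^w(B)) ≤ k(M_I^w(A))`.

To find `W`, decompose `H` into pairwise orthogonal cyclic subspaces generated by vectors `x` such
that the functional `a ↦ ⟨π(a) x, x⟩` has the form `a ↦ ⟨a η, η⟩` for some `η ∈ K`. Each such
subspace then embeds into `K` by an intertwining isometry, and since `I` is infinite and at least
the dimension of `H`, there is room in `K^I` for `I` copies of all of them.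

Such vectors are found under every nonzero `ξ ∈ H`: let `s ∈ M` be the support of `ξ` and choose
`η ∈ s K` with `‖ξ‖ < ‖η‖`. Zorn's lemma, applicable because bounded monotone nets in `M` converge
strongly (Vigier), gives a maximal `0 ≤ a ≤ s` with `⟨a η, η⟩ ≤ ⟨π(a) ξ, ξ⟩`. It is not `s`, and
by maximality `⟨π(b) ξ, ξ⟩ ≤ ⟨b η, η⟩` for all `0 ≤ b ≤ s - a`. With `t = (s - a)^(1/2)` this
yields `‖π(b) π(t) ξ‖ ≤ ‖b t η‖` for all `b ∈ M`, so that `b t η ↦ π(b) π(t) ξ` is a contraction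
and the functional of `π(t) ξ ≠ 0` is given by a vector of `K`.
-/

noncomputable section

namespace Hyperreflexivity

open Filter Topology
open scoped InnerProductSpace

section PositiveOperators

variable {K : Type*} [NormedAddCommGroup K] [InnerProductSpace ℂ K]

theorem reApplyInnerSelf_add (S T : K →L[ℂ] K) (x : K) :
    (S + T).reApplyInnerSelf x = S.reApplyInnerSelf x + T.reApplyInnerSelf x := by
  simp only [ContinuousLinearMap.reApplyInnerSelf_apply, add_apply, inner_add_left, map_add]

theorem reApplyInnerSelf_sub (S T : K →L[ℂ] K) (x : K) :
    (S - T).reApplyInnerSelf x = S.reApplyInnerSelf x - T.reApplyInnerSelf x := by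
  simp only [ContinuousLinearMap.reApplyInnerSelf_apply, sub_apply, inner_sub_left, map_sub]

open scoped ComplexOrder in
theorem le_of_tendsto_apply {ι : Type*} {l : Filter ι} [l.NeBot] {S T : ι → K →L[ℂ] K}
    {D E : K →L[ℂ] K} (hS : ∀ x, Tendsto (fun i => S i x) l (𝓝 (D x)))
    (hT : ∀ x, Tendsto (fun i => T i x) l (𝓝 (E x))) (h : ∀ᶠ i in l, S i ≤ T i) : D ≤ E := by
  have hlim (x : K) : Tendsto (fun i => ⟪(T i - S i) x, x⟫_ℂ) l (𝓝 ⟪(E - D) x, x⟫_ℂ) :=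
    ((hT x).sub (hS x)).inner tendsto_const_nhds
  rw [ContinuousLinearMap.le_def, ContinuousLinearMap.isPositive_iff_complex]
  intro x
  have hpos : ∀ᶠ i in l, 0 ≤ ⟪(T i - S i) x, x⟫_ℂ := h.mono fun i hi =>
    ((ContinuousLinearMap.le_def _ _).1 hi).inner_nonneg_left x
  obtain ⟨hre, him⟩ := RCLike.nonneg_iff.1 (ge_of_tendsto (hlim x) hpos)
  exact ⟨Complex.ext rfl him.symm, hre⟩

theorem reApplyInnerSelf_mono {S T : K →L[ℂ] K} (h : S ≤ T) (x : K) :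
    S.reApplyInnerSelf x ≤ T.reApplyInnerSelf x := by
  rw [← sub_nonneg, ← reApplyInnerSelf_sub]
  exact ((ContinuousLinearMap.le_def S T).1 h).re_inner_nonneg_left x

variable [CompleteSpace K]

theorem reApplyInnerSelf_star_mul_self (T : K →L[ℂ] K) (x : K) :
    (star T * T).reApplyInnerSelf x = ‖T x‖ ^ 2 := by
  rw [ContinuousLinearMap.reApplyInnerSelf_apply, mul_apply_eq_comp,
    ContinuousLinearMap.star_eq_adjoint, ContinuousLinearMap.adjoint_inner_left,
    inner_self_eq_norm_sq]

theorem star_sqrt_mul_sqrt {T : K →L[ℂ] K} (hT : 0 ≤ T) : star (CFC.sqrt T) * CFC.sqrt T = T := by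
  rw [(CFC.sqrt_nonneg T).isSelfAdjoint.star_eq, CFC.sqrt_mul_sqrt_self T hT]

theorem norm_apply_sq_le {T : K →L[ℂ] K} (hT : 0 ≤ T) (x : K) :
    ‖T x‖ ^ 2 ≤ ‖T‖ * T.reApplyInnerSelf x := by
  calc ‖T x‖ ^ 2 = ‖CFC.sqrt T (CFC.sqrt T x)‖ ^ 2 := by
        rw [← mul_apply_eq_comp, CFC.sqrt_mul_sqrt_self T hT]
    _ ≤ (‖CFC.sqrt T‖ * ‖CFC.sqrt T x‖) ^ 2 := by gcongr; exact (CFC.sqrt T).le_opNorm _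
    _ = ‖star (CFC.sqrt T) * CFC.sqrt T‖ * (star (CFC.sqrt T) * CFC.sqrt T).reApplyInnerSelf x := by
        rw [mul_pow, CStarRing.norm_star_mul_self, sq ‖CFC.sqrt T‖, reApplyInnerSelf_star_mul_self]
    _ = ‖T‖ * T.reApplyInnerSelf x := by rw [star_sqrt_mul_sqrt hT]

theorem norm_apply_le_of_star_mul_self_le {S T : K →L[ℂ] K} (h : star S * S ≤ star T * T) (x : K) :
    ‖S x‖ ≤ ‖T x‖ := by
  have hx := reApplyInnerSelf_mono h x
  rw [reApplyInnerSelf_star_mul_self, reApplyInnerSelf_star_mul_self] at hx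
  exact le_of_sq_le_sq hx (norm_nonneg _)

section MonotoneNets

variable {ι : Type*} [Preorder ι] [IsDirectedOrder ι] [Nonempty ι] {T : ι → K →L[ℂ] K}
  {s : K →L[ℂ] K}

theorem cauchySeq_apply_of_monotone (hT : Monotone T) (h0 : ∀ i, 0 ≤ T i) (hs : ∀ i, T i ≤ s)
    (x : K) : CauchySeq fun i => T i x := by
  have hmono : Monotone fun i => (T i).reApplyInnerSelf x :=
    fun i j hij => reApplyInnerSelf_mono (hT hij) x
  have hlim := tendsto_atTop_ciSup hmono
    ⟨s.reApplyInnerSelf x, Set.forall_mem_range.2 fun i => reApplyInnerSelf_mono (hs i) x⟩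
  set L := ⨆ i, (T i).reApplyInnerSelf x
  have hdist {i j : ι} (hij : i ≤ j) :
      ‖T j x - T i x‖ ^ 2 ≤ ‖s‖ * (L - (T i).reApplyInnerSelf x) := by
    have hsub : 0 ≤ T j - T i := sub_nonneg.2 (hT hij)
    calc ‖T j x - T i x‖ ^ 2 = ‖(T j - T i) x‖ ^ 2 := by rw [sub_apply]
      _ ≤ ‖T j - T i‖ * (T j - T i).reApplyInnerSelf x := norm_apply_sq_le hsub x
      _ ≤ ‖s‖ * (L - (T i).reApplyInnerSelf x) := by
        rw [reApplyInnerSelf_sub]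
        gcongr
        · exact sub_nonneg.2 (hmono hij)
        · exact CStarAlgebra.norm_le_norm_of_nonneg_of_le hsub
            ((sub_le_self _ (h0 i)).trans (hs j))
        · exact hmono.ge_of_tendsto hlim j
  have hzero : Tendsto (fun i => ‖s‖ * (L - (T i).reApplyInnerSelf x)) atTop (𝓝 0) := by
    simpa using (hlim.const_sub L).const_mul ‖s‖
  refine Metric.cauchy_iff.2 ⟨inferInstance, fun ε hε => ?_⟩
  obtain ⟨i, hi⟩ := (hzero.eventually_lt_const (show 0 < (ε / 2) ^ 2 by positivity)).exists
  have hball : ∀ᶠ j in atTop, T j x ∈ Metric.ball (T i x) (ε / 2) := by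
    filter_upwards [eventually_ge_atTop i] with j hij
    rw [mem_ball_iff_norm]
    exact lt_of_pow_lt_pow_left₀ 2 (by positivity) ((hdist hij).trans_lt hi)
  exact ⟨_, hball, fun y hy z hz => (dist_triangle_right y z (T i x)).trans_lt
    ((add_lt_add hy hz).trans_eq (add_halves ε))⟩

theorem exists_tendsto_of_monotone (hT : Monotone T) (h0 : ∀ i, 0 ≤ T i) (hs : ∀ i, T i ≤ s) :
    ∃ E : K →L[ℂ] K, ∀ x, Tendsto (fun i => T i x) atTop (𝓝 (E x)) := by
  choose E hE using fun x =>
    cauchySeq_tendsto_of_complete (cauchySeq_apply_of_monotone hT h0 hs x)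
  have hbdd : Bornology.IsBounded (Set.range T) := isBounded_iff_forall_norm_le.2
    ⟨‖s‖, Set.forall_mem_range.2 fun i => CStarAlgebra.norm_le_norm_of_nonneg_of_le (h0 i) (hs i)⟩
  exact ⟨.ofTendstoOfBoundedRange E T (tendsto_pi_nhds.2 hE) hbdd, hE⟩

end MonotoneNets

end PositiveOperators

section Representations

variable {𝒜 : Type*} [Ring 𝒜] [StarRing 𝒜] [Algebra ℂ 𝒜]
  {K : Type*} [NormedAddCommGroup K] [InnerProductSpace ℂ K] [CompleteSpace K]
  {H : Type*} [NormedAddCommGroup H] [InnerProductSpace ℂ H] [CompleteSpace H]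

theorem inner_map_apply_left (ρ : 𝒜 →⋆ₐ[ℂ] (H →L[ℂ] H)) (a : 𝒜) (x y : H) :
    ⟪ρ a x, y⟫_ℂ = ⟪x, ρ (star a) y⟫_ℂ := by
  rw [map_star, ContinuousLinearMap.star_eq_adjoint, ContinuousLinearMap.adjoint_inner_right]

/-- The operators `S : K → H` that intertwine two representations `σ` on `K` and `ρ` on `H`. The
commutant of `σ` is `intertwiners σ σ`. -/
def intertwiners (σ : 𝒜 →⋆ₐ[ℂ] (K →L[ℂ] K)) (ρ : 𝒜 →⋆ₐ[ℂ] (H →L[ℂ] H)) :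
    Submodule ℂ (K →L[ℂ] H) where
  carrier := {S | ∀ a k, S (σ a k) = ρ a (S k)}
  add_mem' hS hT a k := by simp only [add_apply, map_add, hS a k, hT a k]
  zero_mem' a k := by simp only [zero_apply, map_zero]
  smul_mem' c S hS a k := by simp only [smul_apply, map_smul, hS a k]

variable {σ : 𝒜 →⋆ₐ[ℂ] (K →L[ℂ] K)} {ρ : 𝒜 →⋆ₐ[ℂ] (H →L[ℂ] H)}

theorem mem_intertwiners_iff {S : K →L[ℂ] H} :
    S ∈ intertwiners σ ρ ↔ ∀ a, S ∘L σ a = ρ a ∘L S :=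
  forall_congr' fun a => (ContinuousLinearMap.ext_iff (f := S ∘L σ a) (g := ρ a ∘L S)).symm

theorem comp_mem_intertwiners {L : Type*} [NormedAddCommGroup L] [InnerProductSpace ℂ L]
    [CompleteSpace L] {τ : 𝒜 →⋆ₐ[ℂ] (L →L[ℂ] L)} {S : H →L[ℂ] L} {T : K →L[ℂ] H}
    (hS : S ∈ intertwiners ρ τ) (hT : T ∈ intertwiners σ ρ) : S ∘L T ∈ intertwiners σ τ :=
  fun a k => (congrArg S (hT a k)).trans (hS a (T k))

theorem adjoint_mem_intertwiners {S : K →L[ℂ] H} (hS : S ∈ intertwiners σ ρ) :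
    S.adjoint ∈ intertwiners ρ σ := by
  refine fun a x => ext_inner_right ℂ fun k => ?_
  rw [ContinuousLinearMap.adjoint_inner_left, inner_map_apply_left, ← hS,
    inner_map_apply_left, ContinuousLinearMap.adjoint_inner_left]

theorem mem_intertwiners_self_iff {S : K →L[ℂ] K} :
    S ∈ intertwiners σ σ ↔ ∀ a, Commute S (σ a) :=
  mem_intertwiners_iff

theorem sqrt_mem_intertwiners {S : K →L[ℂ] K} (hS : S ∈ intertwiners σ σ) :
    CFC.sqrt S ∈ intertwiners σ σ :=
  mem_intertwiners_self_iff.2 fun a => (mem_intertwiners_self_iff.1 hS a).cfcₙ_nnreal _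

/-- The orbit map `a ↦ ρ a x` of a vector `x` under a representation `ρ`. -/
def orbitMap (ρ : 𝒜 →⋆ₐ[ℂ] (H →L[ℂ] H)) (x : H) : 𝒜 →ₗ[ℂ] H :=
  (ContinuousLinearMap.apply ℂ H x).toLinearMap ∘ₗ (ρ : 𝒜 →ₗ[ℂ] (H →L[ℂ] H))

theorem orbitMap_apply (ρ : 𝒜 →⋆ₐ[ℂ] (H →L[ℂ] H)) (x : H) (a : 𝒜) : orbitMap ρ x a = ρ a x := rfl

theorem apply_orbitMap (ρ : 𝒜 →⋆ₐ[ℂ] (H →L[ℂ] H)) (x : H) (a b : 𝒜) :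
    ρ a (orbitMap ρ x b) = orbitMap ρ x (a * b) := by
  rw [orbitMap_apply, orbitMap_apply, map_mul, mul_apply_eq_comp]

theorem orbitMap_one (ρ : 𝒜 →⋆ₐ[ℂ] (H →L[ℂ] H)) (x : H) : orbitMap ρ x 1 = x := by
  rw [orbitMap_apply, map_one, one_apply_eq_self]

/-- The cyclic subspace `{ρ a x | a}` generated by a vector `x`, without taking its closure. -/
def orbit (ρ : 𝒜 →⋆ₐ[ℂ] (H →L[ℂ] H)) (x : H) : Submodule ℂ H := LinearMap.range (orbitMap ρ x)

theorem mem_orbit_self (ρ : 𝒜 →⋆ₐ[ℂ] (H →L[ℂ] H)) (x : H) : x ∈ orbit ρ x :=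
  ⟨1, orbitMap_one ρ x⟩

theorem apply_mem_closure_orbit (a : 𝒜) {x y : H} (hy : y ∈ (orbit ρ x).topologicalClosure) :
    ρ a y ∈ (orbit ρ x).topologicalClosure := by
  refine Set.MapsTo.closure ?_ (ρ a).continuous hy
  rintro _ ⟨b, rfl⟩
  exact ⟨a * b, (apply_orbitMap ρ x a b).symm⟩

theorem starProjection_mem_intertwiners {U : Submodule ℂ H} [U.HasOrthogonalProjection]
    (hU : ∀ a, ∀ x ∈ U, ρ a x ∈ U) : U.starProjection ∈ intertwiners ρ ρ := by
  refine fun a x => Submodule.eq_starProjection_of_mem_orthogonal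
    (hU a _ (U.starProjection_apply_mem x)) (U.mem_orthogonal _ |>.2 fun u hu => ?_)
  rw [← map_sub, ← star_star a, ← inner_map_apply_left]
  exact U.inner_right_of_mem_orthogonal (hU _ u hu) (U.sub_starProjection_mem_orthogonal x)

theorem exists_intertwiner_of_norm_le {ξ : H} {η : K} (h : ∀ a, ‖ρ a ξ‖ ≤ ‖σ a η‖) :
    ∃ S ∈ intertwiners σ ρ, S η = ξ := by
  set U := (orbit σ η).topologicalClosure
  have hη : η ∈ U := Submodule.le_topologicalClosure _ (mem_orbit_self σ η)
  have hU (a : 𝒜) : ∀ k ∈ U, σ a k ∈ U := fun k hk => apply_mem_closure_orbit a hk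
  let e : 𝒜 →ₗ[ℂ] U := (orbitMap σ η).codRestrict U fun a => hU a η hη
  have he : DenseRange e :=
    Subtype.dense_iff.2 (by rw [← Set.range_comp]; exact subset_rfl)
  let S₀ : U →L[ℂ] H := (orbitMap ρ ξ).extendOfNorm e
  have hS₀ (a : 𝒜) : S₀ (e a) = ρ a ξ :=
    LinearMap.extendOfNorm_eq he ⟨1, fun b => (h b).trans_eq (one_mul _).symm⟩ a
  have hS₀σ (a : 𝒜) (u : U) : S₀ ⟨σ a u, hU a u u.2⟩ = ρ a (S₀ u) := by
    refine he.induction_on u (isClosed_eq ?_ ?_) fun b => ?_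
    · fun_prop
    · fun_prop
    · have hab : (⟨σ a (e b), hU a _ (e b).2⟩ : U) = e (a * b) :=
        Subtype.ext (apply_orbitMap σ η a b)
      rw [hab, hS₀, hS₀, map_mul, mul_apply_eq_comp]
  refine ⟨S₀ ∘L U.orthogonalProjectionOnto, fun a k => ?_, ?_⟩
  · rw [ContinuousLinearMap.comp_apply, ContinuousLinearMap.comp_apply, ← hS₀σ]
    exact congrArg S₀ (Subtype.ext (starProjection_mem_intertwiners hU a k))
  · have he1 : e 1 = ⟨η, hη⟩ := Subtype.ext (orbitMap_one σ η)
    rw [ContinuousLinearMap.comp_apply,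
      Submodule.orthogonalProjectionOnto_mem_subspace_eq_self (⟨η, hη⟩ : U), ← he1, hS₀, map_one,
      one_apply_eq_self]

/-- The functional `a ↦ ⟪ρ a ξ, ξ⟫` on the algebra. -/
def vectorFunctional (ρ : 𝒜 →⋆ₐ[ℂ] (H →L[ℂ] H)) (ξ : H) : 𝒜 → ℂ := fun a => ⟪ρ a ξ, ξ⟫_ℂ

theorem vectorFunctional_mem_range_of_norm_le {ξ : H} {η : K} (h : ∀ a, ‖ρ a ξ‖ ≤ ‖σ a η‖) :
    vectorFunctional ρ ξ ∈ Set.range (vectorFunctional σ) := by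
  obtain ⟨S, hS, rfl⟩ := exists_intertwiner_of_norm_le h
  set R := CFC.sqrt (S.adjoint ∘L S)
  have hS0 : 0 ≤ S.adjoint ∘L S :=
    (ContinuousLinearMap.nonneg_iff_isPositive _).2
      (ContinuousLinearMap.isPositive_adjoint_comp_self S)
  have hR : R ∈ intertwiners σ σ :=
    sqrt_mem_intertwiners (comp_mem_intertwiners (adjoint_mem_intertwiners hS) hS)
  refine ⟨R η, funext fun a => ?_⟩
  calc ⟪σ a (R η), R η⟫_ℂ = ⟪star R (R (σ a η)), η⟫_ℂ := by
        rw [← hR, ContinuousLinearMap.star_eq_adjoint, ContinuousLinearMap.adjoint_inner_left]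
    _ = ⟪S.adjoint (S (σ a η)), η⟫_ℂ := by
        rw [← mul_apply_eq_comp, star_sqrt_mul_sqrt hS0, ContinuousLinearMap.comp_apply]
    _ = ⟪ρ a (S η), S η⟫_ℂ := by rw [hS, ContinuousLinearMap.adjoint_inner_left]

theorem orbit_le_orthogonal_orbit {x y : H} (h : y ∈ (orbit ρ x)ᗮ) : orbit ρ y ≤ (orbit ρ x)ᗮ := by
  rintro _ ⟨a, rfl⟩
  refine (Submodule.mem_orthogonal _ _).2 ?_
  rintro _ ⟨b, rfl⟩
  rw [orbitMap_apply ρ y, ← star_star a, ← inner_map_apply_left, apply_orbitMap]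
  exact Submodule.inner_right_of_mem_orthogonal (LinearMap.mem_range_self (orbitMap ρ x) _) h

theorem exists_cyclic_decomposition {P : H → Prop} (hP : ∀ ξ ≠ 0, ∃ x ∈ orbit ρ ξ, x ≠ 0 ∧ P x) :
    ∃ X : Set H, (∀ x ∈ X, x ≠ 0 ∧ P x) ∧ X.Pairwise (fun x y => orbit ρ x ⟂ orbit ρ y) ∧
      (⨆ x : X, orbit ρ x).topologicalClosure = ⊤ := by
  obtain ⟨X, hX⟩ := zorn_subset
    {X : Set H | (∀ x ∈ X, x ≠ 0 ∧ P x) ∧ X.Pairwise (fun x y => orbit ρ x ⟂ orbit ρ y)}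
    fun c hc hchain => ⟨⋃₀ c,
      ⟨fun x ⟨X, hX, hx⟩ => (hc hX).1 x hx,
        (Set.pairwise_sUnion hchain.directedOn).2 fun X hX => (hc hX).2⟩,
      fun _ => Set.subset_sUnion_of_mem⟩
  obtain ⟨hXP, hXorth⟩ := hX.prop
  refine ⟨X, hXP, hXorth, ?_⟩
  rw [Submodule.topologicalClosure_eq_top_iff, Submodule.eq_bot_iff]
  by_contra! h
  obtain ⟨ξ, hξ, hξ0⟩ := h
  obtain ⟨y, hyξ, hy0, hyP⟩ := hP ξ hξ0
  have hy (x : H) (hx : x ∈ X) : y ∈ (orbit ρ x)ᗮ :=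
    orbit_le_orthogonal_orbit
      (Submodule.orthogonal_le (le_iSup (fun x : X => orbit ρ x) ⟨x, hx⟩) hξ) hyξ
  have hyX : y ∈ X := by
    refine hX.le_of_ge (y := insert y X) ⟨?_, ?_⟩ (Set.subset_insert y X) (Set.mem_insert y X)
    · exact Set.forall_mem_insert.2 ⟨⟨hy0, hyP⟩, hXP⟩
    · refine hXorth.insert fun x hx _ => ?_
      have hyx : orbit ρ y ⟂ orbit ρ x := orbit_le_orthogonal_orbit (hy x hx)
      exact ⟨hyx, hyx.symm⟩
  exact hy0 (inner_self_eq_zero.1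
    (Submodule.inner_right_of_mem_orthogonal (mem_orbit_self ρ y) (hy y hyX)))

theorem inner_orbitMap (x : H) (a b : 𝒜) :
    ⟪orbitMap ρ x a, orbitMap ρ x b⟫_ℂ = vectorFunctional ρ x (star b * a) := by
  rw [vectorFunctional, ← orbitMap_apply, ← apply_orbitMap, inner_map_apply_left, star_star,
    orbitMap_apply ρ x b]

theorem norm_linearCombination_eq_of_inner_eq {T E F : Type*} [NormedAddCommGroup E]
    [InnerProductSpace ℂ E] [NormedAddCommGroup F] [InnerProductSpace ℂ F] {u : T → E} {v : T → F}
    (h : ∀ s t, ⟪u s, u t⟫_ℂ = ⟪v s, v t⟫_ℂ) (l : T →₀ ℂ) :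
    ‖Finsupp.linearCombination ℂ v l‖ = ‖Finsupp.linearCombination ℂ u l‖ := by
  simp only [norm_eq_sqrt_re_inner (𝕜 := ℂ), Finsupp.linearCombination_apply, Finsupp.sum_inner,
    Finsupp.inner_sum, inner_smul_left, inner_smul_right, h]

theorem exists_linearIsometry_of_inner_eq {T E F : Type*} [NormedAddCommGroup E]
    [InnerProductSpace ℂ E] [NormedAddCommGroup F] [InnerProductSpace ℂ F] [CompleteSpace F]
    {u : T → E} {v : T → F} (h : ∀ s t, ⟪u s, u t⟫_ℂ = ⟪v s, v t⟫_ℂ)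
    (hu : Dense (Submodule.span ℂ (Set.range u) : Set E)) :
    ∃ W : E →ₗᵢ[ℂ] F, ∀ t, W (u t) = v t := by
  set e := Finsupp.linearCombination ℂ u
  set g := Finsupp.linearCombination ℂ v
  have hnorm (l : T →₀ ℂ) : ‖g l‖ = ‖e l‖ := norm_linearCombination_eq_of_inner_eq h l
  have he : DenseRange e := by
    rwa [DenseRange, ← LinearMap.coe_range, Finsupp.range_linearCombination]
  let W : E →L[ℂ] F := g.extendOfNorm e
  have hW (l : T →₀ ℂ) : W (e l) = g l :=
    LinearMap.extendOfNorm_eq he ⟨1, fun l => by rw [one_mul, hnorm]⟩ l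
  have hWnorm (z : E) : ‖W z‖ = ‖z‖ :=
    he.induction_on z (isClosed_eq (by fun_prop) (by fun_prop)) fun l => by rw [hW, hnorm]
  refine ⟨⟨W, hWnorm⟩, fun t => ?_⟩
  simpa [e, g] using hW (Finsupp.single t 1)

theorem exists_intertwining_isometry {T : Type*} {x : T → H} {y : T → K}
    (hx : Pairwise fun s t => orbit ρ (x s) ⟂ orbit ρ (x t))
    (hy : Pairwise fun s t => orbit σ (y s) ⟂ orbit σ (y t))
    (htop : (⨆ t, orbit ρ (x t)).topologicalClosure = ⊤)
    (h : ∀ t, vectorFunctional ρ (x t) = vectorFunctional σ (y t)) :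
    ∃ W : H →ₗᵢ[ℂ] K, W.toContinuousLinearMap ∈ intertwiners ρ σ := by
  let u : 𝒜 × T → H := fun p => orbitMap ρ (x p.2) p.1
  let v : 𝒜 × T → K := fun p => orbitMap σ (y p.2) p.1
  have hgram (p q : 𝒜 × T) : ⟪u p, u q⟫_ℂ = ⟪v p, v q⟫_ℂ := by
    obtain ⟨a, s⟩ := p
    obtain ⟨b, t⟩ := q
    rcases eq_or_ne s t with rfl | hst
    · rw [inner_orbitMap, inner_orbitMap, h]
    · rw [(hx hst).inner_eq ⟨a, rfl⟩ ⟨b, rfl⟩, (hy hst).inner_eq ⟨a, rfl⟩ ⟨b, rfl⟩]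
  have hdense : Dense (Submodule.span ℂ (Set.range u) : Set H) := by
    have hle : ⨆ t, orbit ρ (x t) ≤ Submodule.span ℂ (Set.range u) := by
      refine iSup_le fun t => ?_
      rintro _ ⟨a, rfl⟩
      exact Submodule.subset_span ⟨(a, t), rfl⟩
    exact (Submodule.dense_iff_topologicalClosure_eq_top.2 htop).mono hle
  obtain ⟨W, hW⟩ := exists_linearIsometry_of_inner_eq hgram hdense
  refine ⟨W, mem_intertwiners_iff.2 fun a => ContinuousLinearMap.ext_on hdense ?_⟩
  rintro _ ⟨⟨b, t⟩, rfl⟩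
  calc W (ρ a (u (b, t))) = W (u (a * b, t)) := congrArg W (apply_orbitMap ρ (x t) a b)
    _ = v (a * b, t) := hW _
    _ = σ a (v (b, t)) := (apply_orbitMap σ (y t) a b).symm
    _ = σ a (W (u (b, t))) := by rw [hW]

end Representations

section Amplification

variable {𝒜 : Type*} [Ring 𝒜] [StarRing 𝒜] [Algebra ℂ 𝒜]
  {K : Type*} [NormedAddCommGroup K] [InnerProductSpace ℂ K] [CompleteSpace K]
  {H : Type*} [NormedAddCommGroup H] [InnerProductSpace ℂ H] [CompleteSpace H]

/-- The amplification `a ↦ diag(ρ a, ρ a, …)` of a representation `ρ` on `H` to `H^I`. -/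
def amplification (I : Type*) (ρ : 𝒜 →⋆ₐ[ℂ] (H →L[ℂ] H)) :
    𝒜 →⋆ₐ[ℂ] (Ampl I H →L[ℂ] Ampl I H) where
  toFun a := lp.mapCLM 2 (fun _ => ρ a) (norm_nonneg (ρ a)) fun _ => le_rfl
  map_one' := by ext f i; exact congr($(map_one ρ) (f i))
  map_mul' a b := by ext f i; exact congr($(map_mul ρ a b) (f i))
  map_zero' := by ext f i; exact congr($(map_zero ρ) (f i))
  map_add' a b := by ext f i; exact congr($(map_add ρ a b) (f i))
  commutes' c := by ext f i; exact congr($(AlgHomClass.commutes ρ c) (f i))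
  map_star' a := by
    rw [ContinuousLinearMap.star_eq_adjoint, ContinuousLinearMap.eq_adjoint_iff]
    refine fun f g => ?_
    rw [lp.inner_eq_tsum, lp.inner_eq_tsum]
    refine tsum_congr fun i => ?_
    change ⟪ρ (star a) (f i), g i⟫_ℂ = ⟪f i, ρ a (g i)⟫_ℂ
    rw [inner_map_apply_left, star_star]

variable {I J : Type*} {σ : 𝒜 →⋆ₐ[ℂ] (K →L[ℂ] K)} {ρ : 𝒜 →⋆ₐ[ℂ] (H →L[ℂ] H)}

theorem amplification_apply (a : 𝒜) (f : Ampl I H) (i : I) :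
    amplification I ρ a f i = ρ a (f i) := rfl

open scoped Classical in
theorem amplification_single (a : 𝒜) (i : I) (x : H) :
    amplification I ρ a (lp.single 2 i x) = lp.single 2 i (ρ a x) := by
  ext j
  rw [amplification_apply, lp.single_apply, lp.single_apply]
  exact Pi.apply_single (fun _ => ρ a) (fun _ => map_zero (ρ a)) i x j

open scoped Classical in
theorem matrixSpace_intertwiners : matrixSpace I (intertwiners σ ρ) =
    intertwiners (amplification I σ) (amplification I ρ) := by
  have hentry (T : Ampl I K →L[ℂ] Ampl I H) (a : 𝒜) (i j : I) (k : K) :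
      entry T i j (σ a k) = ρ a (entry T i j k) ↔
        T (amplification I σ a (lp.single 2 j k)) i =
          amplification I ρ a (T (lp.single 2 j k)) i := by
    rw [amplification_single, amplification_apply]
    exact Iff.rfl
  ext T
  refine ⟨fun hT => mem_intertwiners_iff.2 fun a => ?_, fun hT i j a k => ?_⟩
  · refine lp.ext_continuousLinearMap (by norm_num) fun j => ?_
    ext k i
    exact (hentry T a i j k).1 (hT i j a k)
  · exact (hentry T a i j k).2 congr($(hT a (lp.single 2 j k)) i)

open scoped Classical in
theorem orbitMap_amplification_single (i : I) (x : H) (a : 𝒜) :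
    orbitMap (amplification I ρ) (lp.single 2 i x) a = lp.single 2 i (orbitMap ρ x a) :=
  amplification_single a i x

open scoped Classical in
theorem vectorFunctional_amplification_single (i : I) (x : H) :
    vectorFunctional (amplification I ρ) (lp.single 2 i x) = vectorFunctional ρ x := by
  ext a
  rw [vectorFunctional, ← orbitMap_apply, orbitMap_amplification_single, lp.inner_single_left,
    lp.single_apply, Pi.single_eq_same, orbitMap_apply, vectorFunctional]

open scoped Classical in
theorem isOrtho_orbit_amplification_single {i j : I} {x y : H}
    (h : i = j → orbit ρ x ⟂ orbit ρ y) :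
    orbit (amplification I ρ) (lp.single 2 i x) ⟂
      orbit (amplification I ρ) (lp.single 2 j y) := by
  rw [Submodule.isOrtho_iff_inner_eq]
  rintro _ ⟨a, rfl⟩ _ ⟨b, rfl⟩
  rw [orbitMap_amplification_single, orbitMap_amplification_single, lp.inner_single_left,
    lp.single_apply]
  rcases eq_or_ne i j with rfl | hij
  · rw [Pi.single_eq_same]
    exact (h rfl).inner_eq ⟨a, rfl⟩ ⟨b, rfl⟩
  · rw [Pi.single_eq_of_ne hij, inner_zero_right]

open scoped Classical in
theorem topologicalClosure_iSup_orbit_amplification_single {T : Type*} {x : T → H}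
    (hx : (⨆ t, orbit ρ (x t)).topologicalClosure = ⊤) :
    (⨆ p : I × T, orbit (amplification I ρ)
      (lp.single 2 p.1 (x p.2))).topologicalClosure = ⊤ := by
  rw [Submodule.topologicalClosure_eq_top_iff] at hx ⊢
  rw [Submodule.eq_bot_iff]
  refine fun f hf => lp.ext (funext fun i => ?_)
  have hfi : f i ∈ (⨆ t, orbit ρ (x t))ᗮ := by
    rw [← Submodule.iInf_orthogonal, Submodule.mem_iInf]
    refine fun t => (Submodule.mem_orthogonal _ _).2 ?_
    rintro _ ⟨a, rfl⟩
    have ha : lp.single 2 i (orbitMap ρ (x t) a) ∈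
        ⨆ p : I × T, orbit (amplification I ρ) (lp.single 2 p.1 (x p.2)) :=
      Submodule.mem_iSup_of_mem (i, t) ⟨a, orbitMap_amplification_single i (x t) a⟩
    have hinner := Submodule.inner_right_of_mem_orthogonal ha hf
    rwa [lp.inner_single_left] at hinner
  rw [hx] at hfi
  exact hfi

theorem exists_amplified_intertwining_isometry {T : Type*} {x : T → H}
    (hx : Pairwise fun s t => orbit ρ (x s) ⟂ orbit ρ (x t))
    (htop : (⨆ t, orbit ρ (x t)).topologicalClosure = ⊤)
    (h : ∀ t, vectorFunctional ρ (x t) ∈ Set.range (vectorFunctional σ)) (φ : I × T ↪ J) :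
    ∃ W : Ampl I H →ₗᵢ[ℂ] Ampl J K, W.toContinuousLinearMap ∈
      intertwiners (amplification I ρ) (amplification J σ) := by
  classical
  choose y hy using h
  refine exists_intertwining_isometry (x := fun p : I × T => lp.single 2 p.1 (x p.2))
    (y := fun p : I × T => lp.single 2 (φ p) (y p.2)) ?_ ?_ ?_ ?_
  · exact fun p q hpq => isOrtho_orbit_amplification_single fun h₁ =>
      hx fun h₂ => hpq (Prod.ext h₁ h₂)
  · exact fun p q hpq => isOrtho_orbit_amplification_single fun h =>
      absurd (φ.injective h) hpq
  · exact topologicalClosure_iSup_orbit_amplification_single htop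
  · intro p
    rw [vectorFunctional_amplification_single, vectorFunctional_amplification_single, hy]

end Amplification

section VonNeumannAlgebras

variable {K : Type*} [NormedAddCommGroup K] [InnerProductSpace ℂ K] [CompleteSpace K]
  {M : VonNeumannAlgebra K}

theorem mem_iff_forall_commute {x : K →L[ℂ] K} : x ∈ M ↔ ∀ y ∈ M.commutant, Commute x y := by
  conv_lhs => rw [← VonNeumannAlgebra.commutant_commutant M, VonNeumannAlgebra.mem_commutant_iff]
  exact forall₂_congr fun y _ => ⟨Commute.symm, Commute.symm⟩

theorem opSpace_eq_intertwiners {𝒜 : Type*} [Ring 𝒜] [StarRing 𝒜] [Algebra ℂ 𝒜]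
    {σ : 𝒜 →⋆ₐ[ℂ] (K →L[ℂ] K)} (hσ : Set.range σ = M.commutant) :
    opSpace M = intertwiners σ σ := by
  ext x
  rw [mem_intertwiners_self_iff]
  refine mem_iff_forall_commute.trans ⟨fun h a => h _ (hσ.le ⟨a, rfl⟩), fun h y hy => ?_⟩
  obtain ⟨a, rfl⟩ := hσ.ge hy
  exact h a

theorem sqrt_mem {x : K →L[ℂ] K} (hx : x ∈ M) : CFC.sqrt x ∈ M :=
  mem_iff_forall_commute.2 fun y hy => (mem_iff_forall_commute.1 hx y hy).cfcₙ_nnreal _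

theorem mem_of_tendsto_apply {ι : Type*} {l : Filter ι} [l.NeBot] {T : ι → K →L[ℂ] K}
    {E : K →L[ℂ] K} (hE : ∀ x, Tendsto (fun i => T i x) l (𝓝 (E x))) (hT : ∀ i, T i ∈ M) :
    E ∈ M := by
  refine mem_iff_forall_commute.2 fun y hy => ContinuousLinearMap.ext fun x => ?_
  refine tendsto_nhds_unique (hE (y x)) ?_
  have hcomm (i : ι) : T i (y x) = y (T i x) :=
    congr($((mem_iff_forall_commute.1 (hT i) y hy).eq) x)
  exact ((y.continuous.tendsto _).comp (hE x)).congr fun i => (hcomm i).symm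

theorem exists_support_projection (ξ : K) :
    ∃ p : M.toStarSubalgebra, IsStarProjection p ∧ (p : K →L[ℂ] K) ξ = ξ ∧
      ∀ f : M.toStarSubalgebra, (f : K →L[ℂ] K) ξ = 0 → f * p = 0 := by
  set ι := M.commutant.toStarSubalgebra.subtype
  set U := (orbit ι ξ).topologicalClosure
  have hmem : U.starProjection ∈ opSpace M := by
    rw [opSpace_eq_intertwiners (σ := ι) Subtype.range_coe]
    exact starProjection_mem_intertwiners fun a x => apply_mem_closure_orbit a
  have hU := isStarProjection_starProjection (U := U)
  refine ⟨⟨U.starProjection, hmem⟩, ⟨Subtype.ext hU.isIdempotentElem, Subtype.ext hU.isSelfAdjoint⟩,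
    Submodule.starProjection_eq_self_iff.2
      (Submodule.le_topologicalClosure _ (mem_orbit_self ι ξ)), fun f hf => ?_⟩
  have hker : U ≤ (f : K →L[ℂ] K).ker := by
    refine Submodule.topologicalClosure_minimal _ ?_ (f : K →L[ℂ] K).isClosed_ker
    rintro _ ⟨b, rfl⟩
    calc (f : K →L[ℂ] K) ((b : K →L[ℂ] K) ξ) = (b : K →L[ℂ] K) ((f : K →L[ℂ] K) ξ) :=
          congr($((mem_iff_forall_commute.1 f.2 b b.2).eq) ξ)
      _ = 0 := by rw [hf, map_zero]
  exact Subtype.ext (ContinuousLinearMap.ext fun x => hker (U.starProjection_apply_mem x))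

end VonNeumannAlgebras

section Domination

variable {K : Type*} [NormedAddCommGroup K] [InnerProductSpace ℂ K] [CompleteSpace K]
  {H : Type*} [NormedAddCommGroup H] [InnerProductSpace ℂ H] [CompleteSpace H]
  {M : VonNeumannAlgebra K} (ρ : M.toStarSubalgebra →⋆ₐ[ℂ] (H →L[ℂ] H))

theorem exists_star_mul_self_eq {a : M.toStarSubalgebra} (ha : 0 ≤ a) :
    ∃ t : M.toStarSubalgebra, star t * t = a :=
  ⟨⟨CFC.sqrt (a : K →L[ℂ] K), sqrt_mem a.2⟩, Subtype.ext (star_sqrt_mul_sqrt ha)⟩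

theorem map_nonneg_of_nonneg {a : M.toStarSubalgebra} (ha : 0 ≤ a) : 0 ≤ ρ a := by
  obtain ⟨t, rfl⟩ := exists_star_mul_self_eq ha
  rw [map_mul, map_star]
  exact star_mul_self_nonneg (ρ t)

theorem map_le_map_of_le {a b : M.toStarSubalgebra} (hab : a ≤ b) : ρ a ≤ ρ b := by
  rw [← sub_nonneg, ← map_sub]
  exact map_nonneg_of_nonneg ρ (sub_nonneg.2 hab)

theorem exists_isLUB_tendsto {c : Set M.toStarSubalgebra} (hc : IsChain (· ≤ ·) c)
    (hne : c.Nonempty) {s : M.toStarSubalgebra} (h0 : ∀ a ∈ c, 0 ≤ a) (hs : ∀ a ∈ c, a ≤ s) :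
    ∃ E, IsLUB c E ∧ ∀ x, Tendsto (fun a : c => (a : K →L[ℂ] K) x) atTop
      (𝓝 ((E : K →L[ℂ] K) x)) := by
  have : Nonempty c := hne.to_subtype
  have : IsDirectedOrder c := DirectedOn.isDirectedOrder hc.directedOn
  have hmono : Monotone fun a : c => (a : K →L[ℂ] K) := fun _ _ hab => hab
  obtain ⟨E, hE⟩ := exists_tendsto_of_monotone hmono (fun a => h0 a a.2) (fun a => hs a a.2)
  refine ⟨⟨E, mem_of_tendsto_apply hE fun a => a.1.2⟩, ⟨fun a ha => ?_, fun b hb => ?_⟩, hE⟩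
  · exact le_of_tendsto_apply (fun _ => tendsto_const_nhds) hE (eventually_ge_atTop (⟨a, ha⟩ : c))
  · exact le_of_tendsto_apply hE (fun _ => tendsto_const_nhds) (.of_forall fun a => hb a.2)

theorem exists_maximal_dominating (s : M.toStarSubalgebra) (hs : 0 ≤ s) (ξ : H) (η : K) :
    ∃ q, Maximal (· ∈ {q : M.toStarSubalgebra | 0 ≤ q ∧ q ≤ s ∧
      (q : K →L[ℂ] K).reApplyInnerSelf η ≤ (ρ q).reApplyInnerSelf ξ}) q := by
  refine (zorn_le_nonempty₀ _ ?_ 0 ?_).imp fun _ => And.right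
  · intro c hcQ hc a₀ ha₀
    obtain ⟨E, hE, hlim⟩ := exists_isLUB_tendsto hc ⟨a₀, ha₀⟩ (fun a ha => (hcQ ha).1)
      fun a ha => (hcQ ha).2.1
    have : Nonempty c := ⟨a₀, ha₀⟩
    have : IsDirectedOrder c := DirectedOn.isDirectedOrder hc.directedOn
    refine ⟨E, ⟨(hcQ ha₀).1.trans (hE.1 ha₀), hE.2 fun a ha => (hcQ ha).2.1, ?_⟩, hE.1⟩
    refine le_of_tendsto ((RCLike.continuous_re.tendsto _).comp
      ((hlim η).inner tendsto_const_nhds)) (.of_forall fun a => ?_)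
    exact (hcQ a.2).2.2.trans (reApplyInnerSelf_mono (map_le_map_of_le ρ (hE.1 a.2)) ξ)
  · exact ⟨le_rfl, hs, by simp [ContinuousLinearMap.reApplyInnerSelf_apply]⟩

theorem exists_dominated_interval {s : M.toStarSubalgebra} (hs : 0 ≤ s) {ξ : H} {η : K}
    (h : (ρ s).reApplyInnerSelf ξ < (s : K →L[ℂ] K).reApplyInnerSelf η) :
    ∃ r, 0 ≤ r ∧ r ≤ s ∧ r ≠ 0 ∧ ∀ a, 0 ≤ a → a ≤ r →
      (ρ a).reApplyInnerSelf ξ ≤ (a : K →L[ℂ] K).reApplyInnerSelf η := by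
  obtain ⟨q, ⟨hq0, hqs, hq⟩, hmax⟩ := exists_maximal_dominating ρ s hs ξ η
  refine ⟨s - q, sub_nonneg.2 hqs, sub_le_self _ hq0, ?_,
    fun a ha has => ?_⟩
  · rintro hsq
    rw [sub_eq_zero.1 hsq] at h
    exact h.not_ge hq
  · by_contra! hlt
    have hqa : q + a ≤ q := by
      refine hmax ⟨add_nonneg hq0 ha, ?_, ?_⟩
        (le_add_of_nonneg_right ha)
      · exact le_sub_iff_add_le'.1 has
      · rw [map_add, reApplyInnerSelf_add]
        exact (reApplyInnerSelf_add _ _ _).trans_le (add_le_add hq hlt.le)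
    have ha0 : a = 0 := le_antisymm (add_le_iff_nonpos_right _ |>.1 hqa) ha
    simp [ha0, ContinuousLinearMap.reApplyInnerSelf_apply] at hlt

theorem norm_map_apply_le_of_dominated {t : M.toStarSubalgebra} {ξ : H} {η : K}
    (h : ∀ a, 0 ≤ a → a ≤ star t * t →
      (ρ a).reApplyInnerSelf ξ ≤ (a : K →L[ℂ] K).reApplyInnerSelf η) (b : M.toStarSubalgebra) :
    ‖ρ b (ρ t ξ)‖ ≤ ‖(b : K →L[ℂ] K) ((t : K →L[ℂ] K) η)‖ := by
  have hcontr (c : M.toStarSubalgebra) (hc : ‖c‖ ≤ 1) :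
      ‖ρ c (ρ t ξ)‖ ≤ ‖(c : K →L[ℂ] K) ((t : K →L[ℂ] K) η)‖ := by
    have hc1 : star (c : K →L[ℂ] K) * c ≤ 1 := by
      rw [← CStarAlgebra.norm_le_one_iff_of_nonneg _ (star_mul_self_nonneg _),
        CStarRing.norm_star_mul_self]
      exact mul_le_one₀ hc (norm_nonneg c) hc
    have hle : star (c * t) * (c * t) ≤ star t * t := by
      have hconj := star_left_conjugate_le_conjugate hc1 (t : K →L[ℂ] K)
      rw [mul_one] at hconj
      rw [star_mul, mul_assoc, ← mul_assoc (star c), ← mul_assoc]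
      exact hconj
    have hdom := h _ (star_mul_self_nonneg ((c * t : M.toStarSubalgebra) : K →L[ℂ] K)) hle
    rw [map_mul, map_star, reApplyInnerSelf_star_mul_self, map_mul] at hdom
    exact le_of_sq_le_sq (hdom.trans_eq (reApplyInnerSelf_star_mul_self _ η)) (norm_nonneg _)
  rcases eq_or_ne b 0 with rfl | hb
  · simp
  have hscale : ‖(‖b‖⁻¹ : ℂ)‖ * ‖ρ b (ρ t ξ)‖ ≤
      ‖(‖b‖⁻¹ : ℂ)‖ * ‖(b : K →L[ℂ] K) ((t : K →L[ℂ] K) η)‖ := by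
    simpa only [map_smul, smul_apply, norm_smul, SetLike.val_smul] using
      hcontr ((‖b‖⁻¹ : ℂ) • b) (norm_smul_inv_norm hb).le
  exact le_of_mul_le_mul_left hscale (by simpa using hb)

theorem exists_dominated_vectorFunctional {s : M.toStarSubalgebra} (hs : 0 ≤ s) {ξ : H} {η : K}
    (h : (ρ s).reApplyInnerSelf ξ < (s : K →L[ℂ] K).reApplyInnerSelf η) :
    ∃ t : M.toStarSubalgebra, t ≠ 0 ∧ star t * t ≤ s ∧
      vectorFunctional ρ (ρ t ξ) ∈ Set.range (vectorFunctional M.toStarSubalgebra.subtype) := by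
  obtain ⟨r, hr0, hrs, hr, hdom⟩ := exists_dominated_interval ρ hs h
  obtain ⟨t, rfl⟩ := exists_star_mul_self_eq hr0
  refine ⟨t, ?_, hrs, vectorFunctional_mem_range_of_norm_le (norm_map_apply_le_of_dominated ρ hdom)⟩
  rintro rfl
  exact hr (mul_zero _)

end Domination

theorem exists_lt_norm_apply_eq_self {K : Type*} [NormedAddCommGroup K] [NormedSpace ℂ K]
    {p : K →L[ℂ] K} (hp : IsIdempotentElem p) (hp0 : p ≠ 0) (c : ℝ) : ∃ η, p η = η ∧ c < ‖η‖ := by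
  obtain ⟨x, hx⟩ : ∃ x, p x ≠ 0 := by simpa using DFunLike.ne_iff.1 hp0
  have : Nontrivial p.range := ⟨⟨p x, x, rfl⟩, 0, fun h => hx congr(($h : K))⟩
  obtain ⟨⟨_, y, rfl⟩, hy⟩ := NormedSpace.exists_lt_norm ℂ p.range c
  exact ⟨p y, congr($(hp.eq) y), hy⟩

section Isomorphisms

variable {K : Type*} [NormedAddCommGroup K] [InnerProductSpace ℂ K] [CompleteSpace K]
  {H : Type*} [NormedAddCommGroup H] [InnerProductSpace ℂ H] [CompleteSpace H]
  {M : VonNeumannAlgebra K} {N : VonNeumannAlgebra H}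

/-- An isomorphism onto a von Neumann algebra on `H`, regarded as a representation on `H`. -/
def toRepresentation (π : M.toStarSubalgebra ≃⋆ₐ[ℂ] N.toStarSubalgebra) :
    M.toStarSubalgebra →⋆ₐ[ℂ] (H →L[ℂ] H) :=
  N.toStarSubalgebra.subtype.comp π

theorem range_toRepresentation (π : M.toStarSubalgebra ≃⋆ₐ[ℂ] N.toStarSubalgebra) :
    Set.range (toRepresentation π) = N :=
  ((EquivLike.surjective π).range_comp _).trans Subtype.range_coe

variable (π : M.toStarSubalgebra ≃⋆ₐ[ℂ] N.toStarSubalgebra)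

theorem exists_map_support_projection (ξ : H) :
    ∃ s : M.toStarSubalgebra, IsStarProjection s ∧ toRepresentation π s ξ = ξ ∧
      ∀ f, toRepresentation π f ξ = 0 → f * s = 0 := by
  obtain ⟨p, hp, hpξ, hsupp⟩ := exists_support_projection (M := N) ξ
  refine ⟨π.symm p, hp.map π.symm, ?_, fun f hf => ?_⟩
  · exact congr(($(π.apply_symm_apply p) : H →L[ℂ] H) ξ).trans hpξ
  · have hfp : π f * p = 0 := hsupp (π f) hf
    rw [← π.symm_apply_apply f, ← map_mul, hfp, map_zero]

theorem exists_mem_orbit_vectorFunctional_mem_range {ξ : H} (hξ : ξ ≠ 0) :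
    ∃ x ∈ orbit (toRepresentation π) ξ, x ≠ 0 ∧
      vectorFunctional (toRepresentation π) x ∈
        Set.range (vectorFunctional M.toStarSubalgebra.subtype) := by
  obtain ⟨s, hs, hsξ, hsupp⟩ := exists_map_support_projection π ξ
  have hs0 : s ≠ 0 := by
    rintro rfl
    exact hξ (by simpa using hsξ.symm)
  have hsK : IsStarProjection (s : K →L[ℂ] K) := hs.map M.toStarSubalgebra.subtype
  obtain ⟨η, hsη, hlt⟩ := exists_lt_norm_apply_eq_self hsK.isIdempotentElem (by simpa using hs0) ‖ξ‖
  have hdom : (toRepresentation π s).reApplyInnerSelf ξ < (s : K →L[ℂ] K).reApplyInnerSelf η := by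
    rw [ContinuousLinearMap.reApplyInnerSelf_apply, hsξ, ContinuousLinearMap.reApplyInnerSelf_apply,
      hsη, inner_self_eq_norm_sq, inner_self_eq_norm_sq]
    gcongr
  obtain ⟨t, ht0, hts, hvec⟩ := exists_dominated_vectorFunctional _ hsK.nonneg hdom
  refine ⟨_, ⟨t, rfl⟩, fun htξ => ht0 ?_, hvec⟩
  have hle : star (t : K →L[ℂ] K) * t ≤ star (s : K →L[ℂ] K) * s := by
    rw [hsK.isSelfAdjoint.star_eq, hsK.isIdempotentElem.eq]
    exact hts
  have hker (x : K) : (t : K →L[ℂ] K) (x - (s : K →L[ℂ] K) x) = 0 := by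
    refine norm_le_zero_iff.1 ((norm_apply_le_of_star_mul_self_le hle _).trans_eq ?_)
    rw [map_sub, ← mul_apply_eq_comp, hsK.isIdempotentElem.eq, sub_self, norm_zero]
  have hts : t = t * s := Subtype.ext <| ContinuousLinearMap.ext fun x => by
    rw [← sub_eq_zero, ← hker x, map_sub]; rfl
  rw [hts, hsupp t htξ]

end Isomorphisms

section Cardinality

variable {H : Type*} [NormedAddCommGroup H] [InnerProductSpace ℂ H]

theorem orthonormal_inv_norm_smul {X : Set H} (h0 : ∀ x ∈ X, x ≠ 0)
    (hX : X.Pairwise fun x y => ⟪x, y⟫_ℂ = 0) :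
    Orthonormal ℂ fun x : X => (‖(x : H)‖⁻¹ : ℂ) • (x : H) := by
  refine ⟨fun x => norm_smul_inv_norm (h0 x x.2), fun x y hxy => ?_⟩
  dsimp only
  rw [inner_smul_left, inner_smul_right, hX x.2 y.2 (Subtype.coe_ne_coe.2 hxy), mul_zero, mul_zero]

theorem countable_setOf_inner_ne_zero {X : Set H} (h0 : ∀ x ∈ X, x ≠ 0)
    (hX : X.Pairwise fun x y => ⟪x, y⟫_ℂ = 0) (v : H) : {x : X | ⟪(x : H), v⟫_ℂ ≠ 0}.Countable := by
  refine ((orthonormal_inv_norm_smul h0 hX).inner_products_summable v).countable_support.mono ?_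
  intro x hx
  simpa [inner_smul_left, h0 x x.2] using hx

theorem exists_inner_hilbertBasis_ne_zero {ι : Type*} (e : HilbertBasis ι ℂ H) {x : H}
    (hx : x ≠ 0) : ∃ i, ⟪x, e i⟫_ℂ ≠ 0 := by
  by_contra! h
  refine hx (e.repr.map_eq_zero_iff.1 (lp.ext (funext fun i => ?_)))
  rw [e.repr_apply_apply, inner_eq_zero_symm.1 (h i)]
  rfl

theorem nonempty_embedding_prod_nat {α β : Type*} (f : α → β)
    (hf : ∀ b, Countable {a // f a = b}) : Nonempty (α ↪ β × ℕ) := by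
  choose g hg using fun b => exists_injective_nat {a // f a = b}
  exact ⟨(Equiv.sigmaFiberEquiv f).symm.toEmbedding.trans <|
    (Function.Embedding.sigmaMap (.refl β) fun b => ⟨g b, hg b⟩).trans
      (Equiv.sigmaEquivProd β ℕ).toEmbedding⟩

theorem exists_embedding_prod_of_pairwise_orthogonal {I : Type w} [Infinite I] {ι : Type x}
    (e : HilbertBasis ι ℂ H)
    (hcard : Cardinal.lift.{w} (Cardinal.mk ι) ≤ Cardinal.lift.{x} (Cardinal.mk I))
    {X : Set H} (h0 : ∀ x ∈ X, x ≠ 0) (hX : X.Pairwise fun x y => ⟪x, y⟫_ℂ = 0) :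
    Nonempty (I × X ↪ I) := by
  choose i hi using fun x : X => exists_inner_hilbertBasis_ne_zero e (h0 x x.2)
  obtain ⟨j⟩ := nonempty_embedding_prod_nat i fun b =>
    ((countable_setOf_inner_ne_zero h0 hX (e b)).mono fun x hx => hx ▸ hi x).to_subtype
  obtain ⟨k⟩ := Cardinal.lift_mk_le'.1 hcard
  obtain ⟨m⟩ : Nonempty (I × I ≃ I) := Cardinal.eq.1 (by simp)
  let f : X ↪ I := (j.trans (k.prodMap (Infinite.natEmbedding I))).trans m.toEmbedding
  exact ⟨((Function.Embedding.refl I).prodMap f).trans m.toEmbedding⟩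

theorem countable_of_orthonormal [TopologicalSpace.SeparableSpace H] {ι : Type*} {v : ι → H}
    (hv : Orthonormal ℂ v) : Countable ι := by
  have hdist {i j : ι} (hij : i ≠ j) : 1 ≤ ‖v i - v j‖ := by
    have h := norm_inner_le_norm (𝕜 := ℂ) (v i - v j) (v i)
    rwa [inner_sub_left, hv.2 hij.symm, sub_zero, inner_self_eq_norm_sq_to_K, hv.1, mul_one,
      RCLike.ofReal_one, one_pow, norm_one] at h
  refine Pairwise.countable_of_isOpen_disjoint (s := fun i => Metric.ball (v i) (1 / 2))
    (fun i j hij => Metric.ball_disjoint_ball ?_) (fun i => Metric.isOpen_ball)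
    fun i => Metric.nonempty_ball.2 (by norm_num)
  rw [dist_eq_norm]
  linarith [hdist hij]

end Cardinality

section Corners

theorem enorm_inner_le_rad {E F : Type*} [NormedAddCommGroup E] [InnerProductSpace ℂ E]
    [NormedAddCommGroup F] [InnerProductSpace ℂ F] {U : Submodule ℂ (E →L[ℂ] F)} {ξ : E} {η : F}
    (hξ : ‖ξ‖ ≤ 1) (hη : ‖η‖ ≤ 1) (h : ∀ X ∈ U, ⟪X ξ, η⟫_ℂ = 0) (T : E →L[ℂ] F) :
    ‖⟪T ξ, η⟫_ℂ‖ₑ ≤ rad U T := by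
  rcases eq_or_ne ξ 0 with rfl | hξ0
  · simp
  rcases eq_or_ne η 0 with rfl | hη0
  · simp
  set ξ' := (‖ξ‖⁻¹ : ℂ) • ξ
  set η' := (‖η‖⁻¹ : ℂ) • η
  have hinner (X : E →L[ℂ] F) : ⟪X ξ, η⟫_ℂ = (‖ξ‖ * ‖η‖ : ℝ) * ⟪X ξ', η'⟫_ℂ := by
    have hξ0' : (‖ξ‖ : ℂ) ≠ 0 := by simpa using hξ0
    have hη0' : (‖η‖ : ℂ) ≠ 0 := by simpa using hη0
    simp only [ξ', η', map_smul, inner_smul_left, inner_smul_right, map_inv₀, Complex.conj_ofReal,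
      Complex.ofReal_mul]
    field_simp
  have hann (X : E →L[ℂ] F) (hX : X ∈ U) : ⟪X ξ', η'⟫_ℂ = 0 := by
    simp only [ξ', η', map_smul, inner_smul_left, inner_smul_right, h X hX, mul_zero]
  calc ‖⟪T ξ, η⟫_ℂ‖ₑ ≤ ‖⟪T ξ', η'⟫_ℂ‖ₑ := by
        rw [enorm_le_iff_norm_le, hinner, norm_mul, Complex.norm_real, norm_mul, norm_norm,
          norm_norm]
        exact mul_le_of_le_one_left (norm_nonneg _) (mul_le_one₀ hξ (norm_nonneg η) hη)
    _ ≤ rad U T := by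
      simp only [rad]
      exact le_iSup_of_le ξ' <| le_iSup_of_le η' <| le_iSup_of_le (norm_smul_inv_norm hξ0) <|
        le_iSup₂_of_le (norm_smul_inv_norm hη0) hann le_rfl

variable {E F E' F' : Type*} [NormedAddCommGroup E] [InnerProductSpace ℂ E]
  [NormedAddCommGroup F] [InnerProductSpace ℂ F] [CompleteSpace F]
  [NormedAddCommGroup E'] [InnerProductSpace ℂ E']
  [NormedAddCommGroup F'] [InnerProductSpace ℂ F'] [CompleteSpace F']
  {U : Submodule ℂ (E →L[ℂ] F)} {V : Submodule ℂ (E' →L[ℂ] F')}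

theorem dist_adjoint_comp_comp_le {R : E →L[ℂ] E'} {S : F →L[ℂ] F'} (hR : ‖R‖ ≤ 1) (hS : ‖S‖ ≤ 1)
    (hVU : ∀ X ∈ V, S.adjoint ∘L X ∘L R ∈ U) (T : E' →L[ℂ] F') :
    dist U (S.adjoint ∘L T ∘L R) ≤ dist V T := by
  refine le_iInf₂ fun X hX => iInf₂_le_of_le _ (hVU X hX) ?_
  rw [← ContinuousLinearMap.comp_sub, ← ContinuousLinearMap.sub_comp, enorm_le_iff_norm_le]
  calc ‖S.adjoint ∘L (T - X) ∘L R‖ ≤ ‖S.adjoint‖ * (‖T - X‖ * ‖R‖) :=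
        (ContinuousLinearMap.opNorm_comp_le _ _).trans
          (mul_le_mul_of_nonneg_left (ContinuousLinearMap.opNorm_comp_le _ _) (norm_nonneg _))
    _ ≤ 1 * (‖T - X‖ * 1) := by
        gcongr
        exact (LinearIsometryEquiv.norm_map _ S).trans_le hS
    _ = ‖T - X‖ := by ring

variable [CompleteSpace E] [CompleteSpace E']

theorem rad_comp_comp_adjoint_le {R : E →L[ℂ] E'} {S : F →L[ℂ] F'} (hR : ‖R‖ ≤ 1) (hS : ‖S‖ ≤ 1)
    (hUV : ∀ X ∈ U, S ∘L X ∘L R.adjoint ∈ V) (T : E →L[ℂ] F) :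
    rad V (S ∘L T ∘L R.adjoint) ≤ rad U T := by
  have hinner (X : E →L[ℂ] F) (ξ : E') (η : F') :
      ⟪(S ∘L X ∘L R.adjoint) ξ, η⟫_ℂ = ⟪X (R.adjoint ξ), S.adjoint η⟫_ℂ :=
    (S.adjoint_inner_right _ _).symm
  refine iSup_le fun ξ => iSup_le fun η => iSup_le fun hξ => iSup₂_le fun hη h => ?_
  rw [hinner]
  refine enorm_inner_le_rad ?_ ?_ (fun X hX => (hinner X ξ η).symm.trans (h _ (hUV X hX))) T
  · exact (R.adjoint.unit_le_opNorm ξ hξ.le).trans ((LinearIsometryEquiv.norm_map _ R).trans_le hR)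
  · exact (S.adjoint.unit_le_opNorm η hη.le).trans ((LinearIsometryEquiv.norm_map _ S).trans_le hS)

theorem hyperConst_le_of_corner (R : E →ₗᵢ[ℂ] E') (S : F →ₗᵢ[ℂ] F')
    (hUV : ∀ X ∈ U, S.toContinuousLinearMap ∘L X ∘L R.toContinuousLinearMap.adjoint ∈ V)
    (hVU : ∀ X ∈ V, S.toContinuousLinearMap.adjoint ∘L X ∘L R.toContinuousLinearMap ∈ U) :
    hyperConst U ≤ hyperConst V := by
  refine iSup₂_le fun T hT => ?_
  set T' := S.toContinuousLinearMap ∘L T ∘L R.toContinuousLinearMap.adjoint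
  have hcompress : S.toContinuousLinearMap.adjoint ∘L T' ∘L R.toContinuousLinearMap = T := by
    have hR := R.toContinuousLinearMap.norm_map_iff_adjoint_comp_self.1 R.norm_map
    have hS := S.toContinuousLinearMap.norm_map_iff_adjoint_comp_self.1 S.norm_map
    ext z
    exact congr($hS (T ($hR z)))
  have hT' : T' ∉ V := fun h => hT (hcompress ▸ hVU T' h)
  refine le_iSup₂_of_le T' hT' (ENNReal.div_le_div ?_ ?_)
  · conv_lhs => rw [← hcompress]
    exact dist_adjoint_comp_comp_le R.norm_toContinuousLinearMap_le S.norm_toContinuousLinearMap_le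
      hVU T'
  · exact rad_comp_comp_adjoint_le R.norm_toContinuousLinearMap_le S.norm_toContinuousLinearMap_le
      hUV T

end Corners

section MatrixSpaces

variable {K : Type*} [NormedAddCommGroup K] [InnerProductSpace ℂ K] [CompleteSpace K]
  {H : Type*} [NormedAddCommGroup H] [InnerProductSpace ℂ H] [CompleteSpace H]

theorem hyperConst_matrixSpace_intertwiners_le {𝒜 : Type*} [Ring 𝒜] [StarRing 𝒜] [Algebra ℂ 𝒜]
    {σ : 𝒜 →⋆ₐ[ℂ] (K →L[ℂ] K)} {ρ : 𝒜 →⋆ₐ[ℂ] (H →L[ℂ] H)} {I J : Type*}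
    {W : Ampl I H →ₗᵢ[ℂ] Ampl J K}
    (hW : W.toContinuousLinearMap ∈ intertwiners (amplification I ρ) (amplification J σ)) :
    hyperConst (matrixSpace I (intertwiners ρ ρ)) ≤
      hyperConst (matrixSpace J (intertwiners σ σ)) := by
  rw [matrixSpace_intertwiners, matrixSpace_intertwiners]
  have hW' := adjoint_mem_intertwiners hW
  exact hyperConst_le_of_corner W W
    (fun X hX => comp_mem_intertwiners hW (comp_mem_intertwiners hX hW'))
    fun X hX => comp_mem_intertwiners hW' (comp_mem_intertwiners hX hW)

theorem exists_amplified_intertwining_isometry_of_equiv {M : VonNeumannAlgebra K}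
    {N : VonNeumannAlgebra H} (π : M.toStarSubalgebra ≃⋆ₐ[ℂ] N.toStarSubalgebra)
    {I : Type w} [Infinite I] {ι : Type x} (e : HilbertBasis ι ℂ H)
    (hcard : Cardinal.lift.{w} (Cardinal.mk ι) ≤ Cardinal.lift.{x} (Cardinal.mk I)) :
    ∃ W : Ampl I H →ₗᵢ[ℂ] Ampl I K, W.toContinuousLinearMap ∈ intertwiners
      (amplification I (toRepresentation π)) (amplification I M.toStarSubalgebra.subtype) := by
  obtain ⟨X, hX, horth, htop⟩ := exists_cyclic_decomposition
    fun _ => exists_mem_orbit_vectorFunctional_mem_range π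
  have hinner : X.Pairwise fun x y => ⟪x, y⟫_ℂ = 0 := horth.mono' fun x y h =>
    h.inner_eq (mem_orbit_self _ x) (mem_orbit_self _ y)
  obtain ⟨φ⟩ :=
    exists_embedding_prod_of_pairwise_orthogonal e hcard (fun x hx => (hX x hx).1) hinner
  exact exists_amplified_intertwining_isometry (x := fun x : X => (x : H)) (horth.subtype _ _) htop
    (fun x => (hX x x.2).2) φ

theorem hyperConst_matrixSpace_le (A : VonNeumannAlgebra K) (B : VonNeumannAlgebra H)
    (π : A.commutant.toStarSubalgebra ≃⋆ₐ[ℂ] B.commutant.toStarSubalgebra)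
    {I : Type w} [Infinite I] {ι : Type x} (e : HilbertBasis ι ℂ H)
    (hcard : Cardinal.lift.{w} (Cardinal.mk ι) ≤ Cardinal.lift.{x} (Cardinal.mk I)) :
    hyperConst (matrixSpace I (opSpace B)) ≤ hyperConst (matrixSpace I (opSpace A)) := by
  obtain ⟨W, hW⟩ := exists_amplified_intertwining_isometry_of_equiv π e hcard
  rw [opSpace_eq_intertwiners (range_toRepresentation π),
    opSpace_eq_intertwiners (M := A) (σ := A.commutant.toStarSubalgebra.subtype) Subtype.range_coe]
  exact hyperConst_matrixSpace_intertwiners_le hW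

theorem hyperConst_matrixSpace_nat_le [TopologicalSpace.SeparableSpace H]
    (A : VonNeumannAlgebra K) (B : VonNeumannAlgebra H)
    (π : A.commutant.toStarSubalgebra ≃⋆ₐ[ℂ] B.commutant.toStarSubalgebra) :
    hyperConst (matrixSpace ℕ (opSpace B)) ≤ hyperConst (matrixSpace ℕ (opSpace A)) := by
  obtain ⟨s, e, -⟩ := exists_hilbertBasis ℂ H
  have : Countable s := countable_of_orthonormal e.orthonormal
  exact hyperConst_matrixSpace_le A B π e (by simp)

end MatrixSpaces

end Hyperreflexivity

end

theorem theorem4p7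
    {K : Type u} [NormedAddCommGroup K] [InnerProductSpace ℂ K] [CompleteSpace K]
    {H : Type v} [NormedAddCommGroup H] [InnerProductSpace ℂ H] [CompleteSpace H]
    (A : VonNeumannAlgebra K) (B : VonNeumannAlgebra H)
    (π : A.commutant.toStarSubalgebra ≃⋆ₐ[ℂ] B.commutant.toStarSubalgebra) :
    (∀ (I : Type w) [Infinite I] (ι : Type x) (_ : HilbertBasis ι ℂ H),
      Cardinal.lift.{w} (Cardinal.mk ι) ≤ Cardinal.lift.{x} (Cardinal.mk I) →
        Hyperreflexivity.hyperConst
            (Hyperreflexivity.matrixSpace I (Hyperreflexivity.opSpace B)) ≤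
          Hyperreflexivity.hyperConst
            (Hyperreflexivity.matrixSpace I (Hyperreflexivity.opSpace A))) ∧
    (TopologicalSpace.SeparableSpace K → TopologicalSpace.SeparableSpace H →
      Hyperreflexivity.hyperConst
          (Hyperreflexivity.matrixSpace ℕ (Hyperreflexivity.opSpace B)) =
        Hyperreflexivity.hyperConst
          (Hyperreflexivity.matrixSpace ℕ (Hyperreflexivity.opSpace A))) := by
  refine ⟨fun I _ ι e hcard => Hyperreflexivity.hyperConst_matrixSpace_le A B π e hcard,
    fun _ _ => le_antisymm ?_ ?_⟩
  · exact Hyperreflexivity.hyperConst_matrixSpace_nat_le A B π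
  · exact Hyperreflexivity.hyperConst_matrixSpace_nat_le B A π.symm
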